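/- **Setting.** A language $L$ is a set of pairs $(x,y)$ of equally long words over $\{0,1\}$; $L_n$ is its $n$-bit section, viewed as a Boolean function on $\{0,1\}^n\times\{0,1\}^n$, equivalently a $2^n\times 2^n$ Boolean matrix. A real sequence $(a_n)$ is *polylogarithmically bounded* if there is a $k$ with $a_n\le(\log_2 n)^k$ for all sufficiently large $n$. A *guess protocol* is a sequence $\Pi=(\Pi_1,\dots,\Pi_l)$, $l\ge1$, of deterministic two-party protocols with one-bit output; it computes $f$ if for all $(x,y)$: $f(x,y)=1$ iff more than half of the $\Pi_i$ accept $(x,y)$. Its cost is $\lceil\log_2 l\rceil+\max_i \mathrm D(\Pi_i)$, where $\mathrm D$ is the worst-case number of bits exchanged; $\mathrm{PP}(f)$ is the minimum cost of a guess protocol computing $f$. $\mathrm{PP}^{cc}$ is the class of languages for which $\mathrm{PP}(L_n)$ is polylogarithmically bounded. $\mathrm{PH}^{cc}=\bigcup_k\Sigma_k^{cc}$, where $L\in\Sigma_k^{cc}$ iff there are a polylogarithmically bounded $l(n)\in\mathbb N$ and Boolean functions $\varphi_n,\psi_n$ such that for all $n$-bit words $x,y$ $$(x,y)\in L\iff \exists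 u_1\forall u_2\exists u_3\cdots Q_ku_k\;\bigl(\varphi_n(x,u_1,\dots,u_k)\diamond\psi_n(y,u_1,\dots,u_k)\bigr),\qquad u_i\in\{0,1\}^{l(n)},$$ with alternating quantifiers, where $\diamond$ is $\vee$ for even $k$ and $\wedge$ for odd $k$. A *measure* $\mu$ assigns a real number to every Boolean function on $\{0,1\}^n\times\{0,1\}^n$, for every $n$. It is a *lower-bound method* for a class $\mathcal C$ of languages if $\mu(L_n)$ is polylogarithmically bounded for every $L\in\mathcal C$. For $0<\epsilon<1/2$ its *BP-perturbation* is $$(\mathrm{BP}_\epsilon\cdot\mu)(f)=\max_{\nu}\ \min_{g:\ \nu(f\ne g)\le\epsilon}\mu(g),$$ where $\nu$ ranges over the probability distributions on the entries of $f$ and $g$ over the Boolean functions on the same domain; $\mathrm{BP}\cdot\mu$ stands for $\epsilon=1/3$. For a real matrix $A$: $\mathrm{disc}(A)$ is the minimum over the probability distributions $\nu$ on the entries of $\max_{S\times T}\bigl|\sum_{(x,y)\in S\times T}\nu(x,y)A(x,y)\bigr|$ over all combinatorial rectangles; $\gamma_2(A)$ is the minimum, over all factorizations $A(x,y)=\langle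 u_x,v_y\rangle$ in finite-dimensional Euclidean spaces, of $\max_x\|u_x\|\cdot\max_y\|v_y\|$; and $\gamma_2^\infty(A)=\min\{\gamma_2(B): A(x,y)B(x,y)\ge1\text{ for all }x,y\}$. For a sign matrix $A$, $\mathrm{mc}(A)$ is the minimum, over all families of unit vectors $u_x,v_y$ in finite-dimensional Euclidean spaces with $\operatorname{sign}\langle u_x,v_y\rangle=A(x,y)$ for all $x,y$, of $\max_{x,y}1/|\langle u_x,v_y\rangle|$. (Each minimum is read as an infimum.) These are applied to a Boolean matrix $f$ through the sign matrix $A_f=J-2f$, where $J$ is the all-ones matrix. The *mc-rigidity* $\mathrm{rig}(f,t)$ is the least number of entries in which $f$ has to be changed to obtain a Boolean matrix $g$ with $\mathrm{mc}(A_g)\le t$. **Corollary.** 1. If $\mu$ is a lower-bound method for $\mathrm{PP}^{cc}$, then for every $0<\epsilon<1/2$ (in particular for $\epsilon=1/3$) $\mathrm{BP}_\epsilon\cdot\mu$ is a lower-bound method for $\mathrm{PH}^{cc}$. 2. In particular, each of the measures $\log_2(1/\mathrm{disc}(A_f))$, $\log_2\gamma_2^\infty(A_f)$ and $\log_2\mathrm{mc}(A_f)$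 is a lower-bound method for $\mathrm{PP}^{cc}$, and its BP-perturbations, for all $0<\epsilon<1/2$, are lower-bound methods for $\mathrm{PH}^{cc}$. 3. Consequently, languages of high mc-rigidity lie outside $\mathrm{PH}^{cc}$: for every $L\in\mathrm{PH}^{cc}$ there is a $k$ such that for every $\epsilon>0$ and all sufficiently large $n$, $$\mathrm{rig}\bigl(L_n,\,2^{(\log_2 n)^k}\bigr)\le\epsilon\cdot4^n .$$ -/

import Mathlib

open Filter

noncomputable section

namespace CommCC

/-! ### Inputs, languages, polylogarithmic growth -/

/-- Words of length `n` over the alphabet `{0,1}`. -/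
abbrev Bits (n : ℕ) : Type := Fin n → Bool

/-- Boolean matrices with rows `X` and columns `Y`, i.e. Boolean functions on `X × Y`. -/
abbrev BoolMat (X Y : Type) : Type := X → Y → Bool

/-- A language, i.e. a set of pairs of words of equal length, given by its `n`-bit sections:
`(x, y)` with `|x| = |y| = n` belongs to `L` iff `L n x y = true`. -/
abbrev CCLanguage : Type := ∀ n : ℕ, BoolMat (Bits n) (Bits n)

/-- `a n ≤ polylog n`. Constant factors are absorbed by the exponent. -/
def PolylogBounded (a : ℕ → ℝ) : Prop :=
  ∃ k : ℕ, ∀ᶠ n : ℕ in atTop, a n ≤ (Real.logb 2 (n : ℝ)) ^ k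

/-! ### Deterministic protocols and guess protocols -/

/-- Deterministic two-party protocols (protocol trees) over `X × Y` with range `{0,1}`. At an inner
node one of the players sends one bit that depends on her or his input; the bit `false` leads to the
first subtree, `true` to the second. -/
inductive Protocol (X Y : Type) : Type
  | output (b : Bool) : Protocol X Y
  | alice (q : X → Bool) (P₀ P₁ : Protocol X Y) : Protocol X Y
  | bob (q : Y → Bool) (P₀ P₁ : Protocol X Y) : Protocol X Y

/-- The function computed by a deterministic protocol. -/
def Protocol.eval {X Y : Type} : Protocol X Y → BoolMat X Y
  | .output b, _, _ => b
  | .alice q P₀ P₁, x, y => if q x then P₁.eval x y else P₀.eval x y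
  | .bob q P₀ P₁, x, y => if q y then P₁.eval x y else P₀.eval x y

/-- Worst-case number of bits exchanged. -/
def Protocol.cost {X Y : Type} : Protocol X Y → ℕ
  | .output _ => 0
  | .alice _ P₀ P₁ => 1 + max P₀.cost P₁.cost
  | .bob _ P₀ P₁ => 1 + max P₀.cost P₁.cost

/-- A guess protocol: a finite nonempty sequence of deterministic protocols. -/
structure GuessProtocol (X Y : Type) : Type where
  guesses : ℕ
  guesses_pos : 0 < guesses
  prot : Fin guesses → Protocol X Y

namespace GuessProtocol

variable {X Y : Type}

/-- Number of accepting guesses. -/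
def acc (P : GuessProtocol X Y) (x : X) (y : Y) : ℕ :=
  (Finset.univ.filter fun i => (P.prot i).eval x y = true).card

/-- Number of rejecting guesses. -/
def rej (P : GuessProtocol X Y) (x : X) (y : Y) : ℕ :=
  (Finset.univ.filter fun i => (P.prot i).eval x y = false).card

/-- `P` computes `f` in PP acceptance mode. -/
def ComputesPP (P : GuessProtocol X Y) (f : BoolMat X Y) : Prop :=
  ∀ x y, f x y = true ↔ P.rej x y < P.acc x y

/-- `⌈log₂ l⌉ + maxᵢ D(Πᵢ)`, where `l` is the number of guesses. -/
def cost (P : GuessProtocol X Y) : ℕ :=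
  Nat.clog 2 P.guesses + Finset.univ.sup fun i => (P.prot i).cost

end GuessProtocol

/-- PP communication complexity of a Boolean function. -/
def PPComplexity {X Y : Type} (f : BoolMat X Y) : ℕ :=
  sInf {c | ∃ P : GuessProtocol X Y, P.ComputesPP f ∧ c = P.cost}

/-- The class `PP^cc`. -/
def PPcc : Set CCLanguage :=
  {L | PolylogBounded fun n => (PPComplexity (L n) : ℝ)}

/-! ### The polynomial hierarchy of communication complexity -/

/-- `Alternate W true k R` is `∃ u₁ ∀ u₂ ∃ u₃ … R [u₁, …, u_k]` with `k` alternating quantifiers over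
`W`; `Alternate W false k R` starts with `∀` instead. -/
def Alternate (W : Type) : Bool → ℕ → (List W → Prop) → Prop
  | _, 0, R => R []
  | true, k + 1, R => ∃ u, Alternate W false k fun us => R (u :: us)
  | false, k + 1, R => ∀ u, Alternate W true k fun us => R (u :: us)

/-- The class `Σ_k^cc` of Babai, Frankl and Simon: `(x, y) ∈ L` iff
`∃ u₁ ∀ u₂ … Q u_k, φ(x, u) ◇ ψ(y, u)`, where the `uᵢ` are words of polylogarithmic length and
`◇` is `∨` for even `k` and `∧` for odd `k`. -/
def SigmaCC (k : ℕ) : Set CCLanguage :=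
  {L | ∃ l : ℕ → ℕ, PolylogBounded (fun n => (l n : ℝ)) ∧
    ∃ φ ψ : ∀ n : ℕ, Bits n → List (Bits (l n)) → Bool,
      ∀ (n : ℕ) (x y : Bits n), L n x y = true ↔
        Alternate (Bits (l n)) true k fun us =>
          if Even k then (φ n x us = true ∨ ψ n y us = true)
          else (φ n x us = true ∧ ψ n y us = true)}

/-- The class `PH^cc`. -/
def PHcc : Set CCLanguage := ⋃ k : ℕ, SigmaCC k

/-! ### Lower-bound methods and the BP-operator -/

/-- A measure assigns a real number to every Boolean function on pairs of `n`-bit words. -/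
abbrev CCMeasure : Type := ∀ n : ℕ, BoolMat (Bits n) (Bits n) → ℝ

/-- `Λ` is a lower-bound method for the class `C`: it is polylogarithmic on the members of `C`, so
that a language on which `Λ` is not polylogarithmic lies outside `C`. -/
def IsLowerBoundMethod (C : Set CCLanguage) (Λ : CCMeasure) : Prop :=
  ∀ L ∈ C, PolylogBounded fun n => Λ n (L n)

section Matrices

variable {X Y : Type} [Fintype X] [Fintype Y]

/-- The probability `μ(f ≠ g)`, for a distribution `μ` on the entries. -/
def errorProb (μ : stdSimplex ℝ (X × Y)) (f g : BoolMat X Y) : ℝ :=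
  ∑ p : X × Y, if f p.1 p.2 ≠ g p.1 p.2 then μ.1 p else 0

/-- The BP-operator `(BP_ε·Λ)(f) = max_μ min {Λ(g) | μ(f ≠ g) ≤ ε}`. -/
def BP (ε : ℝ) (Λ : BoolMat X Y → ℝ) (f : BoolMat X Y) : ℝ :=
  ⨆ μ : stdSimplex ℝ (X × Y), ⨅ g : {g : BoolMat X Y // errorProb μ f g ≤ ε}, Λ g.1

end Matrices

/-- The BP-operator applied to a measure. -/
def CCMeasure.bp (ε : ℝ) (Λ : CCMeasure) : CCMeasure := fun n => BP ε (Λ n)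

/-! ### Discrepancy, the `γ₂^∞` norm, margin complexity -/

section Matrices

variable {X Y : Type} [Fintype X] [Fintype Y]

/-- The sign matrix `J - 2B` of a Boolean matrix `B`. -/
def signMatrix (f : BoolMat X Y) (x : X) (y : Y) : ℝ := if f x y then -1 else 1

/-- Discrepancy: the minimum over all distributions `μ` on the entries of the maximum over all
combinatorial rectangles `S × T` of `|∑_{x ∈ S, y ∈ T} μ(x,y) A(x,y)|`. -/
def disc (A : X → Y → ℝ) : ℝ :=
  ⨅ μ : stdSimplex ℝ (X × Y), ⨆ R : Finset X × Finset Y,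
    |∑ x ∈ R.1, ∑ y ∈ R.2, μ.1 (x, y) * A x y|

/-- The `γ₂` norm: the minimum over all factorizations of `A` of the largest norm of a row of the
left factor times the largest norm of a column of the right factor. -/
def gammaTwo (A : X → Y → ℝ) : ℝ :=
  sInf {t | ∃ (d : ℕ) (u : X → EuclideanSpace ℝ (Fin d)) (v : Y → EuclideanSpace ℝ (Fin d)),
    (∀ x y, A x y = inner ℝ (u x) (v y)) ∧ t = (⨆ x, ‖u x‖) * (⨆ y, ‖v y‖)}

/-- `γ₂^∞(A) = min {γ₂(B) | A(x,y) B(x,y) ≥ 1 for all x, y}`. -/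
def gammaTwoInfty (A : X → Y → ℝ) : ℝ :=
  sInf {t | ∃ B : X → Y → ℝ, (∀ x y, 1 ≤ A x y * B x y) ∧ t = gammaTwo B}

/-- Margin complexity: the minimum of `max_{x,y} 1/|⟨u_x, v_y⟩|` over all realizations of the sign
matrix `A` by unit vectors `u_x, v_y`, i.e. with `sign ⟨u_x, v_y⟩ = A(x,y)`. -/
def marginComplexity (A : X → Y → ℝ) : ℝ :=
  sInf {t | ∃ (d : ℕ) (u : X → EuclideanSpace ℝ (Fin d)) (v : Y → EuclideanSpace ℝ (Fin d)),
    (∀ x, ‖u x‖ = 1) ∧ (∀ y, ‖v y‖ = 1) ∧ (∀ x y, 0 < A x y * inner ℝ (u x) (v y)) ∧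
    t = ⨆ p : X × Y, 1 / |(inner ℝ (u p.1) (v p.2) : ℝ)|}

/-- mc-rigidity: the least number of entries of `f` that have to be changed to obtain a matrix of
margin complexity at most `t`. -/
def mcRigidity (f : BoolMat X Y) (t : ℝ) : ℕ :=
  sInf {N | ∃ g : BoolMat X Y, marginComplexity (signMatrix g) ≤ t ∧
    N = (Finset.univ.filter fun p : X × Y => f p.1 p.2 ≠ g p.1 p.2).card}

end Matrices

/-- The discrepancy method, `log (1 / disc)`. -/
def discMethod : CCMeasure := fun _ f => Real.logb 2 (1 / disc (signMatrix f))

/-- The `γ₂^∞` method, `log γ₂^∞`. -/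
def gammaTwoInftyMethod : CCMeasure := fun _ f => Real.logb 2 (gammaTwoInfty (signMatrix f))

/-- The margin complexity method, `log mc`. -/
def marginMethod : CCMeasure := fun _ f => Real.logb 2 (marginComplexity (signMatrix f))

end CommCC

end

/-! Up to an additive constant, `PPComplexity f` is the logarithm of the number of signed rectangles
in an integer sum whose sign pattern is `f` (`isSignRect_ppComplexity`,
`IsSignRect.ppComplexity_le`). All three claims become statements about such sums.

The core is a Toda-type argument. Fix a distribution on the entries. An OR of predicates `f u` is
replaced by the polynomial `1 - ∏ j (1 - ∑ u ∈ S j, F u)` in their integer approximations, where the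
sets `S j` are chosen so that on most of the weight some `S j` contains exactly one true `u`
(Valiant–Vazirani isolation, with the sets fixed by averaging). Universal quantifiers are handled by
complement. After boundedly many quantifiers there are still only quasipolynomially many rectangles,
and thresholding gives `exists_isSignRect_of_mem_PHcc`: every language in PH is within `1/(n+1)` of
such a sign pattern, for every distribution.

A lower-bound method is polylogarithmic only along each single language, with no uniform bound. So
for each `n` one takes the worst sign pattern of the allowed size; these form one language in PP,
which dominates all approximators. Discrepancy, `γ₂^∞` and margin complexity are bounded directly by
the number of rectangles, and rigidity is the case of the uniform distribution. -/

namespace CommCC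

/-! ### Signed sums of combinatorial rectangles. -/

/-- `F` is a sum of at most `N` signed indicator functions of combinatorial rectangles. -/
def IsRectSum {X Y : Type} (N : ℕ) (F : X → Y → ℤ) : Prop :=
  ∃ (s : Fin N → ℤ) (a : Fin N → X → Bool) (b : Fin N → Y → Bool), (∀ i, |s i| ≤ 1) ∧
    ∀ x y, F x y = ∑ i, if (a i x && b i y) = true then s i else 0

namespace IsRectSum

variable {X Y : Type} {N M : ℕ} {F G : X → Y → ℤ}

theorem of_fintype {ι : Type} [Fintype ι] (s : ι → ℤ) (a : ι → X → Bool) (b : ι → Y → Bool)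
    (hs : ∀ i, |s i| ≤ 1)
    (hF : ∀ x y, F x y = ∑ i, if (a i x && b i y) = true then s i else 0) :
    IsRectSum (Fintype.card ι) F := by
  let e := (Fintype.equivFin ι).symm
  refine ⟨fun i => s (e i), fun i => a (e i), fun i => b (e i), fun i => hs _, fun x y => ?_⟩
  rw [hF, ← e.sum_comp]

theorem zero : IsRectSum N (fun (_ : X) (_ : Y) => 0) :=
  ⟨fun _ => 0, fun _ _ => false, fun _ _ => false, by simp, by simp⟩

theorem rect (a : X → Bool) (b : Y → Bool) :
    IsRectSum 1 (fun x y => if (a x && b y) = true then 1 else 0) :=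
  ⟨fun _ => 1, fun _ => a, fun _ => b, by simp, by simp⟩

theorem one : IsRectSum 1 (fun (_ : X) (_ : Y) => 1) := by
  simpa using rect (fun _ : X => true) (fun _ : Y => true)

theorem add (hF : IsRectSum N F) (hG : IsRectSum M G) :
    IsRectSum (N + M) (fun x y => F x y + G x y) := by
  obtain ⟨s, a, b, hs, h⟩ := hF
  obtain ⟨s', a', b', hs', h'⟩ := hG
  have := of_fintype (F := fun x y => F x y + G x y) (Sum.elim s s') (Sum.elim a a')
    (Sum.elim b b') (by rintro (i | i) <;> simp [hs, hs'])
    (fun x y => by rw [h, h', Fintype.sum_sum_type]; rfl)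
  simpa using this

theorem mono (hF : IsRectSum N F) (h : N ≤ M) : IsRectSum M F := by
  obtain ⟨d, rfl⟩ := Nat.exists_eq_add_of_le h
  simpa using hF.add (zero (N := d))

theorem neg (hF : IsRectSum N F) : IsRectSum N (fun x y => -F x y) := by
  obtain ⟨s, a, b, hs, h⟩ := hF
  refine ⟨fun i => -s i, a, b, by simpa using hs, fun x y => ?_⟩
  simp only [h]
  rw [← Finset.sum_neg_distrib]
  exact Finset.sum_congr rfl fun i _ => by split_ifs <;> simp

theorem sub (hF : IsRectSum N F) (hG : IsRectSum M G) :
    IsRectSum (N + M) (fun x y => F x y - G x y) := by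
  simpa [sub_eq_add_neg] using hF.add hG.neg

/-- Rectangles are closed under intersection and the bound `|s| ≤ 1` under multiplication. This lets
polynomials be applied to rectangle sums. -/
theorem mul (hF : IsRectSum N F) (hG : IsRectSum M G) :
    IsRectSum (N * M) (fun x y => F x y * G x y) := by
  obtain ⟨s, a, b, hs, h⟩ := hF
  obtain ⟨s', a', b', hs', h'⟩ := hG
  have := of_fintype (F := fun x y => F x y * G x y) (fun p : Fin N × Fin M => s p.1 * s' p.2)
    (fun p x => a p.1 x && a' p.2 x) (fun p y => b p.1 y && b' p.2 y)
    (fun p => by rw [abs_mul]; exact mul_le_one₀ (hs _) (abs_nonneg _) (hs' _))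
    (fun x y => by
      rw [h, h', Fintype.sum_prod_type, Finset.sum_mul_sum]
      refine Finset.sum_congr rfl fun i _ => Finset.sum_congr rfl fun j _ => ?_
      cases a i x <;> cases b i y <;> cases a' j x <;> cases b' j y <;> simp)
  simpa using this

theorem sum {ι : Type} (S : Finset ι) {F : ι → X → Y → ℤ} (hF : ∀ i, IsRectSum N (F i)) :
    IsRectSum (S.card * N) (fun x y => ∑ i ∈ S, F i x y) := by
  classical
  induction S using Finset.induction_on with
  | empty => simpa using zero (N := 0)
  | insert i S hi ih =>
    simp only [Finset.sum_insert hi, Finset.card_insert_of_notMem hi]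
    exact ((hF i).add ih).mono (by ring_nf; rfl)

theorem prod_range (t : ℕ) {F : ℕ → X → Y → ℤ} (hF : ∀ i, IsRectSum N (F i)) :
    IsRectSum (N ^ t) (fun x y => ∏ i ∈ Finset.range t, F i x y) := by
  induction t with
  | zero => simpa using one
  | succ t ih => simpa only [Finset.prod_range_succ, pow_succ] using ih.mul (hF t)

theorem congr (hF : IsRectSum N F) (h : ∀ x y, F x y = G x y) : IsRectSum N G := by
  have : F = G := funext fun x => funext fun y => h x y
  exact this ▸ hF

end IsRectSum

/-! ### Sign patterns of rectangle sums and guess protocols. -/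

/-- `f` is the sign pattern of a nowhere vanishing sum of at most `N` signed rectangles. -/
def IsSignRect {X Y : Type} (N : ℕ) (f : BoolMat X Y) : Prop :=
  ∃ G : X → Y → ℤ, IsRectSum N G ∧ ∀ x y, 1 ≤ (if f x y then G x y else -G x y)

section

variable {X Y : Type} {N : ℕ}

theorem IsSignRect.mono {M : ℕ} {f : BoolMat X Y} (hf : IsSignRect N f) (h : N ≤ M) :
    IsSignRect M f := by
  obtain ⟨G, hG, hs⟩ := hf
  exact ⟨G, hG.mono h, hs⟩

/-- Thresholding an integer sum of rectangles. -/
theorem IsRectSum.isSignRect {F : X → Y → ℤ} (hF : IsRectSum N F) :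
    IsSignRect (2 * N + 1) (fun x y => decide (1 ≤ F x y)) := by
  -- `2F - 1` is odd, hence never zero, and it is positive exactly when `F ≥ 1`.
  refine ⟨fun x y => F x y + F x y - 1, ((hF.add hF).sub IsRectSum.one).mono (by omega),
    fun x y => ?_⟩
  by_cases h : 1 ≤ F x y
  · simp only [h, decide_true, if_true]; omega
  · simp only [h, decide_false, Bool.false_eq_true, if_false]; omega

/-- The inputs reaching a given leaf form a rectangle, and there are at most `2 ^ cost` leaves. -/
theorem Protocol.isRectSum (P : Protocol X Y) :
    IsRectSum (2 ^ P.cost) (fun x y => if P.eval x y = true then 1 else 0) := by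
  induction P with
  | output b => cases b
                · simpa [Protocol.eval] using IsRectSum.zero
                · simpa [Protocol.eval, Protocol.cost] using IsRectSum.one
  | alice q P₀ P₁ h₀ h₁ =>
    refine IsRectSum.congr (IsRectSum.mono
      (((IsRectSum.rect q (fun _ => true)).mul h₁).add
        ((IsRectSum.rect (fun x => !q x) (fun _ => true)).mul h₀)) ?_) ?_
    · have a := Nat.pow_le_pow_right two_pos (le_max_left P₀.cost P₁.cost)
      have b := Nat.pow_le_pow_right two_pos (le_max_right P₀.cost P₁.cost)
      simp only [Protocol.cost, pow_add, pow_one]; omega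
    · intro x y
      cases h : q x <;> simp [Protocol.eval, h]
  | bob q P₀ P₁ h₀ h₁ =>
    refine IsRectSum.congr (IsRectSum.mono
      (((IsRectSum.rect (fun _ => true) q).mul h₁).add
        ((IsRectSum.rect (fun _ => true) (fun x => !q x)).mul h₀)) ?_) ?_
    · have a := Nat.pow_le_pow_right two_pos (le_max_left P₀.cost P₁.cost)
      have b := Nat.pow_le_pow_right two_pos (le_max_right P₀.cost P₁.cost)
      simp only [Protocol.cost, pow_add, pow_one]; omega
    · intro x y
      cases h : q y <;> simp [Protocol.eval, h]

theorem GuessProtocol.acc_add_rej (P : GuessProtocol X Y) (x : X) (y : Y) :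
    P.acc x y + P.rej x y = P.guesses := by
  have := Finset.card_filter_add_card_filter_not (s := (Finset.univ : Finset (Fin P.guesses)))
    (fun i => (P.prot i).eval x y = true)
  simpa [GuessProtocol.acc, GuessProtocol.rej] using this

theorem GuessProtocol.ComputesPP.isSignRect {P : GuessProtocol X Y} {f : BoolMat X Y}
    (h : P.ComputesPP f) : IsSignRect (2 ^ (P.cost + 3)) f := by
  set c := Finset.univ.sup fun i => (P.prot i).cost with hc
  have hacc : IsRectSum (P.guesses * 2 ^ c) (fun x y => (P.acc x y : ℤ)) := by
    have := IsRectSum.sum Finset.univ (fun i => (P.prot i).isRectSum.mono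
      (Nat.pow_le_pow_right two_pos
        (Finset.le_sup (f := fun i => (P.prot i).cost) (Finset.mem_univ i))))
    simp only [Finset.card_univ, Fintype.card_fin] at this
    exact this.congr fun x y => by simp [GuessProtocol.acc]
  have hl : IsRectSum P.guesses (fun (_ : X) (_ : Y) => (P.guesses : ℤ)) := by
    have := IsRectSum.sum (X := X) (Y := Y) (Finset.univ : Finset (Fin P.guesses))
      (fun _ => IsRectSum.one)
    simpa using this
  -- `2 acc - l = acc - rej`. A tie means rejection, so the sum used is `2(acc - rej) - 1`, which is
  -- negative on ties. It has at most `6 · 2 ^ cost + 1 ≤ 2 ^ (cost + 3)` rectangles.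
  have h2 := ((hacc.add hacc).sub hl)
  refine ⟨_, ((h2.add h2).sub IsRectSum.one).mono ?_, fun x y => ?_⟩
  · have h1 : P.guesses ≤ 2 ^ Nat.clog 2 P.guesses := Nat.le_pow_clog one_lt_two _
    have h3 : 1 ≤ 2 ^ c := Nat.one_le_two_pow
    have h4 : P.guesses * 2 ^ c ≤ 2 ^ P.cost := by
      rw [GuessProtocol.cost, pow_add]; exact Nat.mul_le_mul_right _ h1
    have h5 : P.guesses * 1 ≤ P.guesses * 2 ^ c := Nat.mul_le_mul_left _ h3
    have := P.guesses_pos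
    rw [pow_add]; omega
  · have e := P.acc_add_rej x y
    have := h x y
    cases hf : f x y
    · simp only [hf, Bool.false_eq_true, false_iff, not_lt] at this ⊢
      simp only [if_false]; omega
    · simp only [hf, true_iff, if_true] at this ⊢; omega

/-- The guess protocol built from a sum of `N` signed rectangles: each rectangle contributes two
guesses, which agree on the rectangle and cancel outside. -/
theorem IsSignRect.exists_guessProtocol {f : BoolMat X Y} (hN : 0 < N) (hf : IsSignRect N f) :
    ∃ P : GuessProtocol X Y, P.ComputesPP f ∧ P.cost ≤ Nat.clog 2 (N * 2) + 2 := by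
  obtain ⟨G, ⟨s, a, b, hs, hG⟩, hsgn⟩ := hf
  -- A coefficient `0` is possible as well; its two guesses cancel on the rectangle too. Every pair
  -- thus contributes `2 s i` on its rectangle and `0` elsewhere.
  let out : ℤ → Fin 2 → Bool := fun s j => if s = 1 then true else if s = -1 then false
    else decide (j = 0)
  let Q : Fin N → Fin 2 → Protocol X Y := fun i j =>
    .alice (a i) (.output (decide (j = 0)))
      (.bob (b i) (.output (decide (j = 0))) (.output (out (s i) j)))
  let P : GuessProtocol X Y := ⟨N * 2, by omega, fun k =>
    Q (finProdFinEquiv.symm k).1 (finProdFinEquiv.symm k).2⟩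
  have hval : ∀ x y, (P.acc x y : ℤ) - P.rej x y = 2 * G x y := by
    intro x y
    have h1 : (P.acc x y : ℤ) - P.rej x y
        = ∑ k, if (P.prot k).eval x y = true then (1 : ℤ) else -1 := by
      simp only [GuessProtocol.acc, GuessProtocol.rej, Finset.card_filter]
      push_cast
      rw [← Finset.sum_sub_distrib]
      refine Finset.sum_congr rfl fun k _ => ?_
      cases (P.prot k).eval x y <;> simp
    have h2 : (∑ k, if (P.prot k).eval x y = true then (1 : ℤ) else -1)
        = ∑ p : Fin N × Fin 2, if (Q p.1 p.2).eval x y = true then (1 : ℤ) else -1 :=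
      (finProdFinEquiv.symm.sum_comp
        fun p : Fin N × Fin 2 => if (Q p.1 p.2).eval x y = true then (1 : ℤ) else -1)
    rw [h1, h2, Fintype.sum_prod_type, hG, Finset.mul_sum]
    refine Finset.sum_congr rfl fun i _ => ?_
    have h3 : s i = -1 ∨ s i = 0 ∨ s i = 1 := by
      have := abs_le.1 (hs i); omega
    simp only [Fin.sum_univ_two, Q, Protocol.eval, out]
    rcases h3 with h | h | h <;> by_cases h4 : a i x = true <;> by_cases h5 : b i y = true <;>
      simp [h, h4, h5]
  refine ⟨P, fun x y => ?_, ?_⟩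
  · have h1 := hval x y
    have h2 := hsgn x y
    cases hf : f x y
    · simp only [hf, Bool.false_eq_true, if_false, false_iff, not_lt] at h2 ⊢; omega
    · simp only [hf, if_true, true_iff] at h2 ⊢; omega
  · refine Nat.add_le_add le_rfl (Finset.sup_le fun k _ => ?_)
    simp [P, Q, Protocol.cost]

theorem IsSignRect.ppComplexity_le {f : BoolMat X Y} (hN : 0 < N) (hf : IsSignRect N f) :
    PPComplexity f ≤ Nat.clog 2 (N * 2) + 2 := by
  obtain ⟨P, hP, hc⟩ := hf.exists_guessProtocol hN
  refine le_trans (Nat.sInf_le ?_) hc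
  exact ⟨P, hP, rfl⟩

/-- One singleton rectangle per true entry suffices. This crude bound only serves to show that some
guess protocol for `f` exists, so that `PPComplexity f` is attained and is not the default value `0`
of an empty infimum. -/
theorem isSignRect_card [Fintype X] [Fintype Y] (f : BoolMat X Y) :
    ∃ N, 0 < N ∧ IsSignRect N f := by
  classical
  have h := IsRectSum.sum (Finset.univ.filter fun p : X × Y => f p.1 p.2 = true)
    (fun p => IsRectSum.rect (fun x => decide (x = p.1)) (fun y => decide (y = p.2)))
  obtain ⟨G, hG, hs⟩ := h.isSignRect
  refine ⟨_, Nat.succ_pos _, G, hG, fun x y => ?_⟩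
  have h2 := hs x y
  convert h2 using 2
  simp only [Bool.and_eq_true, decide_eq_true_eq]
  rw [← Finset.sum_filter, Finset.sum_const, nsmul_eq_mul, mul_one, Nat.one_le_cast,
    Finset.one_le_card]
  constructor
  · intro hf
    exact ⟨(x, y), by simp [hf]⟩
  · rintro ⟨⟨x', y'⟩, hp⟩
    simp only [Finset.mem_filter, Finset.mem_univ, true_and] at hp
    obtain ⟨hp, rfl, rfl⟩ := hp
    exact hp

theorem isSignRect_ppComplexity [Fintype X] [Fintype Y] (f : BoolMat X Y) :
    IsSignRect (2 ^ (PPComplexity f + 3)) f := by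
  obtain ⟨N, hN, hf⟩ := isSignRect_card f
  obtain ⟨P, hP, -⟩ := hf.exists_guessProtocol hN
  obtain ⟨P', hP', hc⟩ := Nat.sInf_mem
    (s := {c | ∃ P : GuessProtocol X Y, P.ComputesPP f ∧ c = P.cost}) ⟨_, P, hP, rfl⟩
  have := hP'.isSignRect
  rwa [← hc] at this

end

end CommCC

namespace CommCC

/-! ### Isolation of one element by a random set -/

section

variable {W : Type} [Fintype W] [DecidableEq W]

/-- Keep `w` when `r w = 0`. For uniform `r` this says that all of `T` is kept with probability `(K
+ 1)^(-|T|)`, stated without division. -/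
theorem card_functions_fix (K : ℕ) (T : Finset W) :
    (Finset.univ.filter fun r : W → Fin (K + 1) => ∀ w ∈ T, r w = 0).card * (K + 1) ^ T.card
      = (K + 1) ^ Fintype.card W := by
  have h : (Finset.univ.filter fun r : W → Fin (K + 1) => ∀ w ∈ T, r w = 0)
      = Fintype.piFinset fun w => if w ∈ T then {0} else Finset.univ := by
    ext r
    simp only [Finset.mem_filter, Finset.mem_univ, true_and, Fintype.mem_piFinset]
    refine forall_congr' fun w => ?_
    by_cases hw : w ∈ T <;> simp [hw]
  rw [h, Fintype.card_piFinset]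
  have h2 : (K + 1) ^ T.card = ∏ w : W, if w ∈ T then (K + 1) else 1 := by
    simp [Finset.prod_ite_mem]
  rw [h2, ← Finset.prod_mul_distrib]
  have : ∀ w : W, (if w ∈ T then ({0} : Finset (Fin (K + 1))) else Finset.univ).card
      * (if w ∈ T then (K + 1) else 1) = K + 1 := fun w => by
    by_cases hw : w ∈ T <;> simp [hw]
  simp [this]

/-- Second moment bound: if every element of `W` is kept with probability `1/(K+1)`, independently,
then exactly one element of `Z` is kept with probability at least `q (1 - q)`,
`q = |Z| / (K + 1)`. -/
theorem card_isolating_ge (K : ℕ) (Z : Finset W) :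
    ((Z.card : ℝ) / (K + 1)) * (1 - (Z.card : ℝ) / (K + 1)) * (K + 1) ^ Fintype.card W ≤
      ∑ r : W → Fin (K + 1), if (Z.filter fun w => r w = 0).card = 1 then (1 : ℝ) else 0 := by
  have hK : (0 : ℝ) < K + 1 := by positivity
  have hcard : ∀ T : Finset W,
      (∑ r : W → Fin (K + 1), if ∀ w ∈ T, r w = 0 then (1 : ℝ) else 0)
        = (K + 1) ^ Fintype.card W / (K + 1) ^ T.card := by
    intro T
    rw [eq_div_iff (by positivity)]
    have := card_functions_fix K T
    simp only [Finset.sum_boole]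
    exact_mod_cast this
  -- With `s` kept elements of `Z` the left side is `s - s(s - 1) = s(2 - s)`, which is `1` for `s =
  -- 1` and at most `0` for every other `s`.
  have h1 : ∀ r : W → Fin (K + 1),
      (∑ u ∈ Z, if r u = 0 then (1 : ℝ) else 0)
        - ∑ u ∈ Z, ∑ v ∈ Z.erase u, (if r u = 0 ∧ r v = 0 then (1 : ℝ) else 0)
        ≤ if (Z.filter fun w => r w = 0).card = 1 then (1 : ℝ) else 0 := by
    intro r
    set s := (Z.filter fun w => r w = 0).card with hs
    have e1 : (∑ u ∈ Z, if r u = 0 then (1 : ℝ) else 0) = s := by simp [hs]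
    have e2 : ∑ u ∈ Z, ∑ v ∈ Z.erase u, (if r u = 0 ∧ r v = 0 then (1 : ℝ) else 0)
        = s * s - s := by
      have : ∀ u ∈ Z, ∑ v ∈ Z.erase u, (if r u = 0 ∧ r v = 0 then (1 : ℝ) else 0)
          = (if r u = 0 then (1 : ℝ) else 0) * s - (if r u = 0 then (1 : ℝ) else 0) := by
        intro u hu
        rw [← e1, eq_sub_iff_add_eq, Finset.mul_sum, ← Finset.sum_erase_add _ _ hu]
        congr 1
        · exact Finset.sum_congr rfl fun v _ => by
            by_cases h : r u = 0 <;> by_cases h' : r v = 0 <;> simp [h, h']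
        · by_cases h : r u = 0 <;> simp [h]
      rw [Finset.sum_congr rfl this, Finset.sum_sub_distrib, ← Finset.sum_mul, e1]
    rw [e1, e2]
    rcases Nat.lt_or_ge s 2 with h | h
    · interval_cases s <;> norm_num
    · have : (2 : ℝ) ≤ s := by exact_mod_cast h
      split_ifs <;> nlinarith
  refine le_trans ?_ (Finset.sum_le_sum fun r _ => h1 r)
  rw [Finset.sum_sub_distrib, Finset.sum_comm]
  have e3 : ∀ u ∈ Z, (∑ r : W → Fin (K + 1), if r u = 0 then (1 : ℝ) else 0)
      = (K + 1) ^ Fintype.card W / (K + 1) := by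
    intro u _
    simpa using hcard {u}
  have e4 : (∑ r : W → Fin (K + 1), ∑ u ∈ Z, ∑ v ∈ Z.erase u,
      (if r u = 0 ∧ r v = 0 then (1 : ℝ) else 0))
      = ∑ u ∈ Z, ∑ v ∈ Z.erase u, (K + 1 : ℝ) ^ Fintype.card W / (K + 1) ^ 2 := by
    rw [Finset.sum_comm]
    refine Finset.sum_congr rfl fun u _ => ?_
    rw [Finset.sum_comm]
    refine Finset.sum_congr rfl fun v hv => ?_
    have huv : u ≠ v := (Finset.ne_of_mem_erase hv).symm
    have := hcard {u, v}
    rw [Finset.card_pair huv] at this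
    simpa using this
  rw [Finset.sum_congr rfl e3, e4]
  have e5 : ∑ u ∈ Z, ∑ v ∈ Z.erase u, (K + 1 : ℝ) ^ Fintype.card W / (K + 1) ^ 2
      ≤ (Z.card : ℝ) * (Z.card * ((K + 1 : ℝ) ^ Fintype.card W / (K + 1) ^ 2)) := by
    rw [← nsmul_eq_mul]
    refine Finset.sum_le_card_nsmul _ _ _ fun u _ => ?_
    rw [Finset.sum_const, nsmul_eq_mul]
    refine mul_le_mul_of_nonneg_right ?_ (by positivity)
    exact_mod_cast Finset.card_le_card (Finset.erase_subset _ _)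
  rw [Finset.sum_const, nsmul_eq_mul]
  refine le_trans (le_of_eq ?_) (sub_le_sub_left e5 _)
  field_simp

/-- Some set isolates an element on a `1/(8(l+1))` fraction of a weighted family of nonempty
sets. -/
theorem exists_isolating_set {Ω : Type} (A : Finset Ω) (w : Ω → ℝ) (hw : ∀ p, 0 ≤ w p)
    (Z : Ω → Finset W) (hZ : ∀ p ∈ A, (Z p).Nonempty) {l : ℕ} (hl : Fintype.card W ≤ 2 ^ l) :
    ∃ S : Finset W, (∑ p ∈ A, w p) / (8 * (l + 1)) ≤
      ∑ p ∈ A, if (S ∩ Z p).card = 1 then w p else 0 := by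
  by_contra! hcon
  let val : Finset W → ℝ := fun S => ∑ p ∈ A, if (S ∩ Z p).card = 1 then w p else 0
  -- The probability that a random set of density `2^(-(i+2))` isolates an element of `Z p`. If
  -- every set were bad, each of the `l + 1` scales would isolate too little weight on average; yet
  -- each `p` has a scale that suits it.
  let hit : (i : ℕ) → Ω → ℝ := fun i p =>
    (∑ r : W → Fin (2 ^ (i + 2) - 1 + 1),
      if ((Z p).filter fun u => r u = 0).card = 1 then (1 : ℝ) else 0)
      / ((2 : ℝ) ^ (i + 2)) ^ Fintype.card W
  have hnn : ∀ i p, 0 ≤ hit i p := fun i p => by positivity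
  have hK : ∀ i : ℕ, ((2 ^ (i + 2) - 1 : ℕ) : ℝ) + 1 = 2 ^ (i + 2) := fun i => by
    have : 1 ≤ 2 ^ (i + 2) := Nat.one_le_two_pow
    push_cast [Nat.cast_sub this]; ring
  have hpt : ∀ p ∈ A, (1 : ℝ) / 8 ≤ ∑ i ∈ Finset.range (l + 1), hit i p := by
    intro p hp
    set m := (Z p).card with hm
    have hm0 : m ≠ 0 := (Finset.card_pos.2 (hZ p hp)).ne'
    have hi : Nat.log 2 m < l + 1 := by
      rw [Nat.lt_succ_iff, ← Nat.log_pow one_lt_two l]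
      exact Nat.log_mono_right ((Finset.card_le_univ _).trans hl)
    refine le_trans ?_ (Finset.single_le_sum (fun i _ => hnn i p) (Finset.mem_range.2 hi))
    set i := Nat.log 2 m with hidef
    have a1 : (2 : ℝ) ^ i ≤ m := by exact_mod_cast Nat.pow_log_le_self 2 hm0
    have a2 : (m : ℝ) ≤ 2 ^ (i + 1) := by
      exact_mod_cast (Nat.lt_pow_succ_log_self one_lt_two m).le
    have h := card_isolating_ge (2 ^ (i + 2) - 1) (Z p)
    rw [hK, ← hm] at h
    have hpos : (0 : ℝ) < 2 ^ i := by positivity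
    simp only [hit]
    rw [le_div_iff₀ (by positivity)]
    refine le_trans (mul_le_mul_of_nonneg_right ?_ (by positivity)) h
    -- At the scale `i = log₂ |Z p|` the expected number `q` of kept elements lies in `[1/4, 1/2]`,
    -- so `q (1 - q) ≥ 1/8`.
    have q1 : (1 : ℝ) / 4 ≤ m / 2 ^ (i + 2) := by
      rw [le_div_iff₀ (by positivity), pow_add]; linarith
    have q2 : (m : ℝ) / 2 ^ (i + 2) ≤ 1 / 2 := by
      rw [div_le_iff₀ (by positivity), pow_add]; rw [pow_add] at a2; linarith
    nlinarith
  have hsum : ∀ i, ∑ p ∈ A, w p * hit i p < (∑ p ∈ A, w p) / (8 * (l + 1)) := by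
    intro i
    have : ∑ p ∈ A, w p * hit i p
        = (∑ r : W → Fin (2 ^ (i + 2) - 1 + 1), val (Finset.univ.filter fun u => r u = 0))
          / ((2 : ℝ) ^ (i + 2)) ^ Fintype.card W := by
      simp only [val, hit]
      rw [Finset.sum_comm, Finset.sum_div]
      refine Finset.sum_congr rfl fun p _ => ?_
      rw [mul_div_assoc', Finset.mul_sum]
      congr 1
      refine Finset.sum_congr rfl fun r _ => ?_
      have : (Finset.univ.filter fun u => r u = 0) ∩ Z p = (Z p).filter fun u => r u = 0 := by
        ext u; simp [and_comm]
      rw [this]; simp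
    rw [this, div_lt_iff₀ (by positivity)]
    refine (Finset.sum_lt_sum_of_nonempty ⟨fun _ => 0, Finset.mem_univ _⟩
      fun r _ => hcon _).trans_eq ?_
    rw [Finset.sum_const, nsmul_eq_mul, Finset.card_univ, Fintype.card_fun, Fintype.card_fin, mul_comm]
    push_cast
    rw [hK]
  have h1 : (∑ p ∈ A, w p) / 8 ≤ ∑ p ∈ A, ∑ i ∈ Finset.range (l + 1), w p * hit i p := by
    rw [Finset.sum_div]
    refine Finset.sum_le_sum fun p hp => ?_
    rw [← Finset.mul_sum, div_eq_mul_one_div]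
    exact mul_le_mul_of_nonneg_left (hpt p hp) (hw p)
  rw [Finset.sum_comm] at h1
  have h2 := h1.trans_lt (Finset.sum_lt_sum_of_nonempty ⟨0, by simp⟩ fun i _ => hsum i)
  rw [Finset.sum_const, nsmul_eq_mul, Finset.card_range] at h2
  push_cast at h2
  refine h2.ne ?_
  field_simp

/-- Greedy iteration: `t` sets miss at most a `(1 - 1/(8(l+1)))^t` fraction. -/
theorem exists_isolating_sets {Ω : Type} (A : Finset Ω) (w : Ω → ℝ) (hw : ∀ p, 0 ≤ w p)
    (Z : Ω → Finset W) (hZ : ∀ p ∈ A, (Z p).Nonempty) {l : ℕ} (hl : Fintype.card W ≤ 2 ^ l)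
    (t : ℕ) :
    ∃ S : ℕ → Finset W,
      (∑ p ∈ A, if ∃ j < t, (S j ∩ Z p).card = 1 then 0 else w p) ≤
        (1 - 1 / (8 * (l + 1)) : ℝ) ^ t * ∑ p ∈ A, w p := by
  classical
  induction t with
  | zero => exact ⟨fun _ => ∅, by simp⟩
  | succ t ih =>
    obtain ⟨S, hS⟩ := ih
    -- The weight not yet isolated; the next set is chosen for it.
    let w' : Ω → ℝ := fun p => if ∃ j < t, (S j ∩ Z p).card = 1 then 0 else w p
    obtain ⟨S', hS'⟩ := exists_isolating_set A w'
      (fun p => by simp only [w']; split_ifs <;> simp [hw]) Z hZ hl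
    refine ⟨fun j => if j < t then S j else S', ?_⟩
    have e : ∀ p ∈ A, (if ∃ j < t + 1, ((if j < t then S j else S') ∩ Z p).card = 1
        then 0 else w p) = w' p - if (S' ∩ Z p).card = 1 then w' p else 0 := by
      intro p _
      have : (∃ j < t + 1, ((if j < t then S j else S') ∩ Z p).card = 1) ↔
          (∃ j < t, (S j ∩ Z p).card = 1) ∨ (S' ∩ Z p).card = 1 := by
        constructor
        · rintro ⟨j, -, h⟩
          split_ifs at h with hjt
          · exact Or.inl ⟨j, hjt, h⟩
          · exact Or.inr h
        · rintro (⟨j, hj, h⟩ | h)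
          · exact ⟨j, by omega, by rwa [if_pos hj]⟩
          · exact ⟨t, by omega, by rwa [if_neg (lt_irrefl t)]⟩
      rw [if_congr this rfl rfl]
      simp only [w']
      by_cases h1 : ∃ j < t, (S j ∩ Z p).card = 1
      · rw [if_pos (Or.inl h1), if_pos h1]; simp
      · by_cases h2 : (S' ∩ Z p).card = 1
        · simp [h1, h2]
        · simp only [h1, h2, or_self, if_false, sub_zero]
    rw [Finset.sum_congr rfl e, Finset.sum_sub_distrib, pow_succ']
    have hc : (0 : ℝ) ≤ 1 - 1 / (8 * (l + 1)) := by
      rw [sub_nonneg, div_le_one (by positivity)]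
      have : (0 : ℝ) ≤ l := by positivity
      linarith
    have := mul_le_mul_of_nonneg_left hS hc
    calc _ ≤ (∑ p ∈ A, w' p) - (∑ p ∈ A, w' p) / (8 * (l + 1)) := sub_le_sub_left hS' _
      _ = (1 - 1 / (8 * (l + 1)) : ℝ) * ∑ p ∈ A, w' p := by ring
      _ ≤ _ := by rw [mul_assoc]; exact this

/-- `(1 - 1/m)^m ≤ 1/e ≤ 1/2` with `m = 8(l + 1)`. -/
theorem one_sub_inv_pow_le (l d : ℕ) :
    (1 - 1 / (8 * (l + 1)) : ℝ) ^ (8 * (l + 1) * d) ≤ (1 / 2) ^ d := by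
  rw [pow_mul]
  have hc : (0 : ℝ) ≤ 1 - 1 / (8 * (l + 1)) := by
    rw [sub_nonneg, div_le_one (by positivity)]
    have : (0 : ℝ) ≤ l := by positivity
    linarith
  refine pow_le_pow_left₀ (pow_nonneg hc _) ?_ d
  have h1 : (1 - 1 / (8 * (l + 1)) : ℝ) ≤ Real.exp (-(1 / (8 * (l + 1)))) := by
    have := Real.add_one_le_exp (-(1 / (8 * (l + 1))) : ℝ)
    linarith
  refine (pow_le_pow_left₀ hc h1 _).trans ?_
  rw [← Real.exp_nat_mul]
  have : ((8 * (l + 1) : ℕ) : ℝ) * -(1 / (8 * (l + 1))) = -1 := by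
    push_cast; field_simp
  rw [this, Real.exp_neg, one_div]
  refine inv_anti₀ two_pos ?_
  have := Real.add_one_le_exp (1 : ℝ)
  linarith

end
end CommCC

namespace CommCC

/-! ### Approximating alternating quantifiers by sums of rectangles -/

open Classical in
/-- The `w`-weight of the entries on which `F` is not the indicator function of `f`. -/
noncomputable def approxErr {X Y : Type} [Fintype X] [Fintype Y] (w : X × Y → ℝ) (F : X → Y → ℤ)
    (f : X → Y → Prop) : ℝ :=
  ∑ p : X × Y, if F p.1 p.2 = (if f p.1 p.2 then 1 else 0) then 0 else w p

section

variable {X Y : Type} [Fintype X] [Fintype Y] {W : Type} [Fintype W]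

/-- Complementing is free of error, which reduces `∀` to `∃`. -/
theorem approxErr_compl (w : X × Y → ℝ) (F : X → Y → ℤ) (f : X → Y → Prop) :
    approxErr w (fun x y => 1 - F x y) (fun x y => ¬f x y) = approxErr w F f := by
  refine Finset.sum_congr rfl fun p _ => if_congr ?_ rfl rfl
  by_cases h : f p.1 p.2
  · simp only [h, not_true, if_false, if_true]; omega
  · simp only [h, not_false_eq_true, if_false, if_true]; omega

/-- Where all `F u` are correct, the inner sum over `S j` equals `|S j ∩ Z p|`. If some `S j`
isolates, its factor vanishes and `G = 1`; if no `f u` holds, all factors are `1` and `G = 0`. The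
error is a union bound over `u` plus the unisolated weight. At bad entries `G` may be any integer.
-/
theorem exists_approx_or {w : X × Y → ℝ} (hw : ∀ p, 0 ≤ w p) (hw1 : ∑ p, w p ≤ 1)
    {l : ℕ} (hl : Fintype.card W ≤ 2 ^ l) (d : ℕ) {a : ℕ} {e : ℝ}
    {f : W → X → Y → Prop} {F : W → X → Y → ℤ} (hF : ∀ u, IsRectSum (2 ^ a) (F u))
    (he : ∀ u, approxErr w (F u) (f u) ≤ e) :
    ∃ G : X → Y → ℤ, IsRectSum (2 ^ ((l + a + 1) * (8 * (l + 1) * d) + 1)) G ∧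
      approxErr w G (fun x y => ∃ u, f u x y) ≤ Fintype.card W * e + (1 / 2) ^ d := by
  classical
  set t := 8 * (l + 1) * d with ht
  let Z : X × Y → Finset W := fun p => Finset.univ.filter fun u => f u p.1 p.2
  let A : Finset (X × Y) := Finset.univ.filter fun p => ∃ u, f u p.1 p.2
  obtain ⟨S, hS⟩ := exists_isolating_sets A w hw Z
    (fun p hp => by
      obtain ⟨u, hu⟩ := (Finset.mem_filter.1 hp).2
      exact ⟨u, by simp [Z, hu]⟩) hl t
  let G : X → Y → ℤ := fun x y => 1 - ∏ j ∈ Finset.range t, (1 - ∑ u ∈ S j, F u x y)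
  refine ⟨G, ?_, ?_⟩
  · have h1 : ∀ j, IsRectSum (2 ^ (l + a + 1)) fun x y => 1 - ∑ u ∈ S j, F u x y := by
      intro j
      refine (IsRectSum.one.sub (IsRectSum.sum (S j) hF)).mono ?_
      have h2 : (S j).card * 2 ^ a ≤ 2 ^ l * 2 ^ a :=
        Nat.mul_le_mul_right _ ((Finset.card_le_univ _).trans hl)
      rw [← pow_add] at h2
      have h3 : 1 ≤ 2 ^ (l + a) := Nat.one_le_two_pow
      rw [pow_succ]; omega
    refine (IsRectSum.one.sub (IsRectSum.prod_range t h1)).mono ?_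
    rw [← pow_mul]
    have h3 : 1 ≤ 2 ^ ((l + a + 1) * t) := Nat.one_le_two_pow
    rw [pow_succ]; omega
  · have hpt : ∀ p : X × Y,
        (if G p.1 p.2 = (if ∃ u, f u p.1 p.2 then 1 else 0) then 0 else w p) ≤
          (∑ u, if F u p.1 p.2 = (if f u p.1 p.2 then 1 else 0) then 0 else w p) +
          if ∃ u, f u p.1 p.2 then (if ∃ j < t, (S j ∩ Z p).card = 1 then 0 else w p) else 0 := by
      intro p
      have hnn : ∀ u, 0 ≤ if F u p.1 p.2 = (if f u p.1 p.2 then 1 else 0) then 0 else w p :=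
        fun u => by split_ifs <;> simp [hw]
      have hnn1 := Finset.sum_nonneg fun u (_ : u ∈ Finset.univ) => hnn u
      have hnn2 : 0 ≤ if ∃ u, f u p.1 p.2 then
          (if ∃ j < t, (S j ∩ Z p).card = 1 then 0 else w p) else 0 := by
        split_ifs <;> simp [hw]
      by_cases hgood : ∀ u, F u p.1 p.2 = if f u p.1 p.2 then 1 else 0
      · have hsum : ∀ j, ∑ u ∈ S j, F u p.1 p.2 = (S j ∩ Z p).card := by
          intro j
          rw [Finset.sum_congr rfl fun u _ => hgood u, Finset.sum_boole]
          congr 2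
          ext u; simp [Z]
        have hG : G p.1 p.2 = 1 - ∏ j ∈ Finset.range t, (1 - ((S j ∩ Z p).card : ℤ)) := by
          simp only [G, hsum]
        by_cases hex : ∃ u, f u p.1 p.2
        · by_cases hj : ∃ j < t, (S j ∩ Z p).card = 1
          · obtain ⟨j, hjt, hj1⟩ := hj
            have : G p.1 p.2 = 1 := by
              rw [hG, Finset.prod_eq_zero (Finset.mem_range.2 hjt) (by rw [hj1]; simp), sub_zero]
            rw [if_pos (by rw [this, if_pos hex])]
            exact add_nonneg hnn1 hnn2
          · rw [if_pos hex, if_pos hex, if_neg hj]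
            refine le_trans ?_ (le_add_of_nonneg_left hnn1)
            split_ifs <;> simp [hw]
        · have : G p.1 p.2 = 0 := by
            rw [hG]
            have hZ : Z p = ∅ := by
              simp only [Z, Finset.filter_eq_empty_iff]
              exact fun u _ hu => hex ⟨u, hu⟩
            simp [hZ]
          rw [if_pos (by rw [this, if_neg hex])]
          exact add_nonneg hnn1 hnn2
      · push Not at hgood
        obtain ⟨u, hu⟩ := hgood
        have h1 := Finset.single_le_sum (fun u _ => hnn u) (Finset.mem_univ u)
        rw [if_neg hu] at h1
        refine le_trans ?_ (add_le_add h1 hnn2)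
        rw [add_zero]
        split_ifs <;> simp [hw]
    have key := Finset.sum_le_sum fun p (_ : p ∈ Finset.univ) => hpt p
    refine le_trans (le_of_eq ?_) (key.trans ?_)
    · exact Finset.sum_congr rfl fun p _ => by congr!
    rw [Finset.sum_add_distrib, Finset.sum_comm, ← Finset.sum_filter]
    refine add_le_add ?_ ?_
    · rw [← nsmul_eq_mul]
      exact Finset.sum_le_card_nsmul _ _ _ fun u _ => he u
    · refine hS.trans ?_
      rw [← mul_one ((1 / 2 : ℝ) ^ d)]
      refine mul_le_mul (one_sub_inv_pow_le l d) ?_ (Finset.sum_nonneg fun p _ => hw p)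
        (by positivity)
      exact (Finset.sum_le_univ_sum_of_nonneg hw).trans hw1

/-- Binary logarithm of the number of rectangles needed for `k` alternating quantifiers. -/
def altSize (l d : ℕ) : ℕ → ℕ
  | 0 => 2
  | k + 1 => (l + altSize l d k + 2) * (8 * (l + 1) * d) + 2

/-- Induction peels off the outermost quantifier. The error obeys `e ↦ 2^l e + 2^(-d)`, whence the
factor `(2^l + 1)^k`. -/
theorem exists_approx_alternate {w : X × Y → ℝ} (hw : ∀ p, 0 ≤ w p) (hw1 : ∑ p, w p ≤ 1)
    {l : ℕ} (hl : Fintype.card W ≤ 2 ^ l) (d : ℕ) (k : ℕ) (b : Bool)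
    (R : X → Y → List W → Prop)
    (hR : ∀ us, ∃ F : X → Y → ℤ, IsRectSum 4 F ∧ approxErr w F (fun x y => R x y us) ≤ 0) :
    ∃ F : X → Y → ℤ, IsRectSum (2 ^ altSize l d k) F ∧
      approxErr w F (fun x y => Alternate W b k (R x y)) ≤ (2 ^ l + 1) ^ k * (1 / 2) ^ d := by
  induction k generalizing b R with
  | zero =>
    obtain ⟨F, hF, he⟩ := hR []
    refine ⟨F, hF, ?_⟩
    have : (fun x y => Alternate W b 0 (R x y)) = fun x y => R x y [] := by
      cases b <;> rfl
    rw [this]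
    exact he.trans (by positivity)
  | succ k ih =>
    have hbound : Fintype.card W * (((2 : ℝ) ^ l + 1) ^ k * (1 / 2) ^ d) + (1 / 2) ^ d ≤
        (2 ^ l + 1) ^ (k + 1) * (1 / 2) ^ d := by
      have h1 : (Fintype.card W : ℝ) ≤ 2 ^ l := by exact_mod_cast hl
      have h2 : (1 : ℝ) ≤ (2 ^ l + 1) ^ k := one_le_pow₀ (by
        have : (0 : ℝ) ≤ 2 ^ l := by positivity
        linarith)
      have h3 : (0 : ℝ) < (1 / 2) ^ d := by positivity
      have h4 := mul_le_mul_of_nonneg_right h1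
        (by positivity : (0 : ℝ) ≤ (2 ^ l + 1) ^ k * (1 / 2) ^ d)
      have h5 := mul_le_mul_of_nonneg_right h2 h3.le
      rw [pow_succ]
      linarith
    choose F hF he using fun u => ih (!b) (fun x y us => R x y (u :: us)) (fun us => hR (u :: us))
    cases b with
    | true =>
      obtain ⟨G, hG, hGe⟩ := exists_approx_or hw hw1 hl d hF he
      refine ⟨G, hG.mono (Nat.pow_le_pow_right two_pos ?_), hGe.trans hbound⟩
      have := Nat.mul_le_mul_right (8 * (l + 1) * d)
        (by omega : l + altSize l d k + 1 ≤ l + altSize l d k + 2)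
      simp only [altSize]
      omega
    | false =>
      -- De Morgan: complement inside and outside. Each complement adds one to the exponent, which
      -- the two summands `2` in `altSize` allow for.
      obtain ⟨G, hG, hGe⟩ := exists_approx_or (a := altSize l d k + 1) hw hw1 hl d
        (fun u => (IsRectSum.one.sub (hF u)).mono (by
          have : 1 ≤ 2 ^ altSize l d k := Nat.one_le_two_pow
          rw [pow_succ]; omega))
        (fun u => (approxErr_compl w _ _).trans_le (he u))
      refine ⟨fun x y => 1 - G x y, (IsRectSum.one.sub hG).mono ?_, ?_⟩
      · have h1 : ∀ m : ℕ, 1 + 2 ^ (m + 1) ≤ 2 ^ (m + 2) := fun m => by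
          have : 1 ≤ 2 ^ m := Nat.one_le_two_pow
          rw [pow_succ, pow_add]; omega
        exact h1 _
      · rw [← approxErr_compl] at hGe
        simp only [not_exists, not_not] at hGe
        exact hGe.trans hbound

theorem exists_rectSum_and (φ : X → Bool) (ψ : Y → Bool) (w : X × Y → ℝ) :
    ∃ F : X → Y → ℤ, IsRectSum 4 F ∧
      approxErr w F (fun x y => φ x = true ∧ ψ y = true) ≤ 0 := by
  refine ⟨_, (IsRectSum.rect φ ψ).mono (by norm_num), le_of_eq ?_⟩
  refine Finset.sum_eq_zero fun p _ => if_pos ?_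
  simp

theorem exists_rectSum_or (φ : X → Bool) (ψ : Y → Bool) (w : X × Y → ℝ) :
    ∃ F : X → Y → ℤ, IsRectSum 4 F ∧
      approxErr w F (fun x y => φ x = true ∨ ψ y = true) ≤ 0 := by
  refine ⟨_, (IsRectSum.one.sub
    (IsRectSum.rect (fun x => !φ x) (fun y => !ψ y))).mono (by norm_num), le_of_eq ?_⟩
  refine Finset.sum_eq_zero fun p _ => if_pos ?_
  by_cases h : φ p.1 = true <;> by_cases h' : ψ p.2 = true <;> simp [h, h']

end

/-! ### Polylogarithmic growth -/

theorem tendsto_logb_two_nat : Tendsto (fun n : ℕ => Real.logb 2 (n : ℝ)) atTop atTop :=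
  (Real.tendsto_logb_atTop one_lt_two).comp tendsto_natCast_atTop_atTop

namespace PolylogBounded

theorem mono {a b : ℕ → ℝ} (hb : PolylogBounded b) (h : ∀ᶠ n in atTop, a n ≤ b n) :
    PolylogBounded a := by
  obtain ⟨k, hk⟩ := hb
  exact ⟨k, by filter_upwards [hk, h] with n h1 h2 using h2.trans h1⟩

theorem add {a b : ℕ → ℝ} (ha : PolylogBounded a) (hb : PolylogBounded b) :
    PolylogBounded fun n => a n + b n := by
  obtain ⟨j, hj⟩ := ha
  obtain ⟨k, hk⟩ := hb
  -- The extra factor `log₂ n ≥ 2` absorbs the two summands.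
  refine ⟨max j k + 1, ?_⟩
  filter_upwards [hj, hk, tendsto_logb_two_nat.eventually_ge_atTop 2] with n h1 h2 h3
  have h4 := pow_le_pow_right₀ (by linarith : 1 ≤ Real.logb 2 (n : ℝ)) (le_max_left j k)
  have h5 := pow_le_pow_right₀ (by linarith : 1 ≤ Real.logb 2 (n : ℝ)) (le_max_right j k)
  have h6 : 0 ≤ Real.logb 2 (n : ℝ) ^ max j k := by positivity
  rw [pow_succ]
  nlinarith

theorem const (c : ℝ) : PolylogBounded fun _ => c :=
  ⟨1, by filter_upwards [tendsto_logb_two_nat.eventually_ge_atTop c] with n h; simpa using h⟩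

theorem mul {a b : ℕ → ℝ} (ha : PolylogBounded a) (hb : PolylogBounded b) (ha0 : ∀ n, 0 ≤ a n)
    (hb0 : ∀ n, 0 ≤ b n) : PolylogBounded fun n => a n * b n := by
  obtain ⟨j, hj⟩ := ha
  obtain ⟨k, hk⟩ := hb
  refine ⟨j + k, ?_⟩
  filter_upwards [hj, hk] with n h1 h2
  rw [pow_add]
  exact mul_le_mul h1 h2 (hb0 n) ((ha0 n).trans h1)

theorem clog_succ : PolylogBounded fun n => (Nat.clog 2 (n + 1) : ℝ) := by
  refine ⟨2, ?_⟩
  filter_upwards [tendsto_logb_two_nat.eventually_ge_atTop 2, eventually_ge_atTop 1] with n h1 h2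
  have h3 : Nat.clog 2 (n + 1) ≤ Nat.log 2 n + 1 :=
    Nat.clog_le_of_le_pow (Nat.lt_pow_succ_log_self one_lt_two n)
  have h4 : (Nat.log 2 n : ℝ) ≤ Real.logb 2 n := by
    rw [Real.le_logb_iff_rpow_le one_lt_two (by exact_mod_cast h2), Real.rpow_natCast]
    exact_mod_cast Nat.pow_log_le_self 2 (by omega)
  have h5 : (Nat.clog 2 (n + 1) : ℝ) ≤ Nat.log 2 n + 1 := by exact_mod_cast h3
  nlinarith

theorem altSize {l d : ℕ → ℕ} (hl : PolylogBounded fun n => (l n : ℝ))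
    (hd : PolylogBounded fun n => (d n : ℝ)) (k : ℕ) :
    PolylogBounded fun n => (altSize (l n) (d n) k : ℝ) := by
  induction k with
  | zero => exact const ((2 : ℕ) : ℝ)
  | succ k ih =>
    simp only [CommCC.altSize]
    push_cast
    exact (((hl.add ih).add (const 2)).mul
      (((const 8).mul (hl.add (const 1)) (by norm_num) (fun n => by positivity)).mul hd
        (fun n => by positivity) (fun n => by positivity))
      (fun n => by positivity) (fun n => by positivity)).add (const 2)

end PolylogBounded

/-! ### Approximation of languages in the polynomial hierarchy. -/

/-- Every language in the polynomial hierarchy is approximated, with respect to every distribution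
on the entries, by a threshold of quasipolynomially many rectangles. -/
theorem exists_isSignRect_of_mem_PHcc {L : CCLanguage} (hL : L ∈ PHcc) :
    ∃ b : ℕ → ℕ, PolylogBounded (fun n => (b n : ℝ)) ∧
      ∀ (n : ℕ) (μ : stdSimplex ℝ (Bits n × Bits n)), ∃ g : BoolMat (Bits n) (Bits n),
        IsSignRect (2 ^ b n) g ∧ errorProb μ (L n) g ≤ 1 / (n + 1) := by
  classical
  obtain ⟨k, l, hl, φ, ψ, hLk⟩ := Set.mem_iUnion.1 hL
  -- Chosen so that `(2^l + 1)^k ≤ 2^((l+1)k)` is cancelled and a factor at most `1/(n + 1)`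
  -- remains.
  let d : ℕ → ℕ := fun n => (l n + 1) * k + Nat.clog 2 (n + 1)
  have hd : PolylogBounded fun n => (d n : ℝ) := by
    simp only [d]
    push_cast
    exact ((hl.add (.const 1)).mul (.const k) (fun n => by positivity)
      (fun n => by positivity)).add .clog_succ
  refine ⟨fun n => altSize (l n) (d n) k + 2, ?_, fun n μ => ?_⟩
  · push_cast
    exact (PolylogBounded.altSize hl hd k).add (.const 2)
  obtain ⟨F, hF, he⟩ := exists_approx_alternate (W := Bits (l n)) (w := μ.1) μ.2.1 μ.2.2.le
    (l := l n) (by simp) (d n) k true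
    (fun x y us => if Even k then (φ n x us = true ∨ ψ n y us = true)
          else (φ n x us = true ∧ ψ n y us = true)) (fun us => by
      by_cases hk : Even k
      · simpa only [hk, if_true] using exists_rectSum_or (φ n · us) (ψ n · us) μ.1
      · simpa only [hk, if_false] using exists_rectSum_and (φ n · us) (ψ n · us) μ.1)
  -- The approximator is the threshold `F ≥ 1`. It agrees with `L` wherever `F` equals the indicator
  -- of `L`, so its error is at most that of `F`.
  refine ⟨_, hF.isSignRect.mono ?_, ?_⟩
  · have : 1 ≤ 2 ^ altSize (l n) (d n) k := Nat.one_le_two_pow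
    rw [pow_add]; omega
  · have h1 : ((2 : ℝ) ^ l n + 1) ^ k * (1 / 2) ^ d n ≤ 1 / (n + 1) := by
      have h2 : ((2 : ℝ) ^ l n + 1) ^ k ≤ 2 ^ ((l n + 1) * k) := by
        rw [pow_mul]
        refine pow_le_pow_left₀ (by positivity) ?_ k
        have : (1 : ℝ) ≤ 2 ^ l n := one_le_pow₀ one_le_two
        rw [pow_succ]; linarith
      have h3 : ((n : ℝ) + 1) ≤ 2 ^ Nat.clog 2 (n + 1) := by
        exact_mod_cast Nat.le_pow_clog one_lt_two (n + 1)
      rw [one_div_pow, mul_one_div, div_le_div_iff₀ (by positivity) (by positivity), one_mul]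
      simp only [d]
      rw [pow_add]
      exact mul_le_mul h2 h3 (by positivity) (by positivity)
    refine le_trans ?_ (he.trans h1)
    refine Finset.sum_le_sum fun p _ => ?_
    have hiff := hLk n p.1 p.2
    have hp := μ.2.1 p
    by_cases hA : Alternate (Bits (l n)) true k fun us =>
          if Even k then (φ n p.1 us = true ∨ ψ n p.2 us = true)
          else (φ n p.1 us = true ∧ ψ n p.2 us = true)
    · rw [if_pos hA, hiff.2 hA]
      by_cases hF1 : F p.1 p.2 = 1
      · simp [hF1]
      · rw [if_neg hF1]
        split_ifs <;> simp [hp]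
    · have : L n p.1 p.2 = false := by
        rw [← Bool.not_eq_true, hiff]; exact hA
      rw [if_neg hA, this]
      by_cases hF1 : F p.1 p.2 = 0
      · simp [hF1]
      · rw [if_neg hF1]
        split_ifs <;> simp [hp]

end CommCC

namespace CommCC

/-! ### Bounds from sums of rectangles -/

section

variable {X Y : Type} {N : ℕ}

/-- A sum of `N` signed rectangles factors through vectors with `N` entries in `[-1, 1]`. -/
theorem IsRectSum.exists_inner {G : X → Y → ℤ} (hG : IsRectSum N G) :
    ∃ (u : X → EuclideanSpace ℝ (Fin N)) (v : Y → EuclideanSpace ℝ (Fin N)),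
      (∀ x, ‖u x‖ ^ 2 ≤ N) ∧ (∀ y, ‖v y‖ ^ 2 ≤ N) ∧
      ∀ x y, (G x y : ℝ) = inner ℝ (u x) (v y) := by
  obtain ⟨s, a, b, hs, h⟩ := hG
  have hs' : ∀ i, |(s i : ℝ)| ≤ 1 := fun i => by exact_mod_cast hs i
  refine ⟨fun x => WithLp.toLp 2 fun i => if a i x = true then (s i : ℝ) else 0,
    fun y => WithLp.toLp 2 fun i => if b i y = true then (1 : ℝ) else 0,
    fun x => ?_, fun y => ?_, fun x y => ?_⟩
  · rw [EuclideanSpace.norm_sq_eq]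
    refine (Finset.sum_le_card_nsmul _ _ 1 fun i _ => ?_).trans (by simp)
    simp only [Real.norm_eq_abs]
    split_ifs
    · exact pow_le_one₀ (abs_nonneg _) (hs' i)
    · simp
  · rw [EuclideanSpace.norm_sq_eq]
    refine (Finset.sum_le_card_nsmul _ _ 1 fun i _ => ?_).trans (by simp)
    simp only [Real.norm_eq_abs]
    split_ifs <;> simp
  · rw [h, PiLp.inner_apply]
    push_cast
    refine Finset.sum_congr rfl fun i _ => ?_
    by_cases h1 : a i x = true <;> by_cases h2 : b i y = true <;> simp [h1, h2]

theorem gammaTwo_nonneg (A : X → Y → ℝ) : 0 ≤ gammaTwo A := by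
  refine Real.sInf_nonneg ?_
  rintro t ⟨d, u, v, -, rfl⟩
  exact mul_nonneg (Real.iSup_nonneg fun _ => norm_nonneg _)
    (Real.iSup_nonneg fun _ => norm_nonneg _)

theorem IsRectSum.gammaTwo_le {G : X → Y → ℤ} (hG : IsRectSum N G) (c : ℝ) (hc : |c| = 1) :
    gammaTwo (fun x y => c * G x y) ≤ N := by
  obtain ⟨u, v, hu, hv, h⟩ := hG.exists_inner
  have hle : (⨆ x, ‖c • u x‖) * (⨆ y, ‖v y‖) ≤ N := by
    have h1 : (⨆ x, ‖c • u x‖) ≤ √N := Real.iSup_le (fun x => by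
      rw [norm_smul, Real.norm_eq_abs, hc, one_mul]
      exact Real.le_sqrt_of_sq_le (hu x)) (Real.sqrt_nonneg _)
    have h2 : (⨆ y, ‖v y‖) ≤ √N :=
      Real.iSup_le (fun y => Real.le_sqrt_of_sq_le (hv y)) (Real.sqrt_nonneg _)
    refine (mul_le_mul h1 h2 (Real.iSup_nonneg fun _ => norm_nonneg _)
      (Real.sqrt_nonneg _)).trans ?_
    rw [Real.mul_self_sqrt (by positivity)]
  refine le_trans (csInf_le ⟨0, ?_⟩ ?_) hle
  · rintro t ⟨d, u, v, -, rfl⟩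
    exact mul_nonneg (Real.iSup_nonneg fun _ => norm_nonneg _)
      (Real.iSup_nonneg fun _ => norm_nonneg _)
  · refine ⟨N, fun x => c • u x, v, fun x y => ?_, rfl⟩
    rw [inner_smul_left, ← h]; simp

/-- `signMatrix` is `-1` on accepted entries, where `G` is positive; hence the factor `-1` here and
in the bounds below. -/
theorem one_le_signMatrix_mul {f : BoolMat X Y} {G : X → Y → ℤ}
    (h : ∀ x y, 1 ≤ (if f x y then G x y else -G x y)) (x : X) (y : Y) :
    1 ≤ signMatrix f x y * (-1 * (G x y : ℝ)) := by
  have h' : (1 : ℝ) ≤ ((if f x y then G x y else -G x y : ℤ) : ℝ) := by exact_mod_cast h x y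
  cases hf : f x y <;> simp [hf, signMatrix] at h' ⊢ <;> exact h'

theorem gammaTwoInfty_nonneg (A : X → Y → ℝ) : 0 ≤ gammaTwoInfty A := by
  refine Real.sInf_nonneg ?_
  rintro t ⟨B, -, rfl⟩
  exact gammaTwo_nonneg B

theorem IsSignRect.gammaTwoInfty_le {f : BoolMat X Y} (hf : IsSignRect N f) :
    gammaTwoInfty (signMatrix f) ≤ N := by
  obtain ⟨G, hG, hs⟩ := hf
  refine le_trans (csInf_le ⟨0, ?_⟩ ?_) (hG.gammaTwo_le (-1) (by simp))
  · rintro t ⟨B, -, rfl⟩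
    exact gammaTwo_nonneg B
  · exact ⟨_, one_le_signMatrix_mul hs, rfl⟩

theorem marginComplexity_nonneg (A : X → Y → ℝ) : 0 ≤ marginComplexity A := by
  refine Real.sInf_nonneg ?_
  rintro t ⟨d, u, v, -, -, -, rfl⟩
  exact Real.iSup_nonneg fun _ => by positivity

/-- Vectors in the unit ball can be completed to unit vectors with the same inner products. -/
theorem exists_unit_vectors {d : ℕ} (u : X → EuclideanSpace ℝ (Fin d))
    (v : Y → EuclideanSpace ℝ (Fin d)) (hu : ∀ x, ‖u x‖ ^ 2 ≤ 1) (hv : ∀ y, ‖v y‖ ^ 2 ≤ 1) :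
    ∃ (u' : X → EuclideanSpace ℝ (Fin (d + 2))) (v' : Y → EuclideanSpace ℝ (Fin (d + 2))),
      (∀ x, ‖u' x‖ = 1) ∧ (∀ y, ‖v' y‖ = 1) ∧
      ∀ x y, (inner ℝ (u' x) (v' y) : ℝ) = inner ℝ (u x) (v y) := by
  have key : ∀ {Z : Type} (z : Z → EuclideanSpace ℝ (Fin (d + 2))),
      (∀ i, ‖z i‖ ^ 2 = 1) → ∀ i, ‖z i‖ = 1 := fun z h i =>
    (pow_eq_one_iff_of_nonneg (norm_nonneg _) two_ne_zero).1 (h i)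
  -- One new coordinate fills up the rows, the other the columns. They never meet, so inner products
  -- do not change.
  refine ⟨fun x => WithLp.toLp 2 (Fin.cons √(1 - ‖u x‖ ^ 2) (Fin.cons 0 (u x))),
    fun y => WithLp.toLp 2 (Fin.cons 0 (Fin.cons √(1 - ‖v y‖ ^ 2) (v y))),
    key _ fun x => ?_, key _ fun y => ?_, fun x y => ?_⟩
  · have := EuclideanSpace.norm_sq_eq (u x)
    rw [EuclideanSpace.norm_sq_eq]
    simp only [Fin.sum_univ_succ, Fin.cons_zero, Fin.cons_succ, Real.norm_eq_abs, sq_abs] at this ⊢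
    rw [Real.sq_sqrt (by linarith [hu x]), ← this]; ring
  · have := EuclideanSpace.norm_sq_eq (v y)
    rw [EuclideanSpace.norm_sq_eq]
    simp only [Fin.sum_univ_succ, Fin.cons_zero, Fin.cons_succ, Real.norm_eq_abs, sq_abs] at this ⊢
    rw [Real.sq_sqrt (by linarith [hv y]), ← this]; ring
  · simp only [PiLp.inner_apply, Fin.sum_univ_succ, Fin.cons_zero, Fin.cons_succ]
    simp

/-- The vectors of `IsRectSum.exists_inner`, scaled by `∓1/√N`, lie in the unit ball and have inner
products `-G/N`, of absolute value at least `1/N`. -/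
theorem IsSignRect.marginComplexity_le {f : BoolMat X Y} (hN : 0 < N) (hf : IsSignRect N f) :
    marginComplexity (signMatrix f) ≤ N := by
  obtain ⟨G, hG, hs⟩ := hf
  obtain ⟨u, v, hu, hv, h⟩ := hG.exists_inner
  have hN' : (0 : ℝ) < N := by exact_mod_cast hN
  have hc : (√N)⁻¹ ^ 2 * (N : ℝ) = 1 := by
    rw [inv_pow, Real.sq_sqrt hN'.le, inv_mul_cancel₀ hN'.ne']
  have hscale : ∀ (c : ℝ) (z : EuclideanSpace ℝ (Fin N)), c ^ 2 = (√N)⁻¹ ^ 2 → ‖z‖ ^ 2 ≤ N →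
      ‖c • z‖ ^ 2 ≤ 1 := by
    intro c z hcz hz
    rw [norm_smul, mul_pow, Real.norm_eq_abs, sq_abs, hcz, ← hc]
    exact mul_le_mul_of_nonneg_left hz (by positivity)
  obtain ⟨u', v', hu', hv', h'⟩ := exists_unit_vectors (fun x => (-(√N)⁻¹) • u x)
    (fun y => (√N)⁻¹ • v y) (fun x => hscale _ _ (by ring) (hu x))
    (fun y => hscale _ _ rfl (hv y))
  have hval : ∀ x y, (inner ℝ (u' x) (v' y) : ℝ) = -1 * G x y / N := by
    intro x y
    rw [h', inner_smul_left, inner_smul_right, ← h, eq_div_iff hN'.ne']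
    simp only [conj_trivial]
    linear_combination (-(G x y : ℝ)) * hc
  have hmem : ∀ x y, 1 / (N : ℝ) ≤ signMatrix f x y * inner ℝ (u' x) (v' y) := by
    intro x y
    rw [hval, mul_div_assoc']
    exact div_le_div_of_nonneg_right (one_le_signMatrix_mul hs x y) hN'.le
  refine le_trans (csInf_le ⟨0, ?_⟩
    (a := ⨆ p : X × Y, 1 / |(inner ℝ (u' p.1) (v' p.2) : ℝ)|) ?_) ?_
  · rintro t ⟨d, u, v, -, -, -, rfl⟩
    exact Real.iSup_nonneg fun _ => by positivity
  · exact ⟨N + 2, u', v', hu', hv',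
      fun x y => lt_of_lt_of_le (by positivity) (hmem x y), rfl⟩
  · refine Real.iSup_le (fun p => ?_) hN'.le
    have h1 : |(signMatrix f p.1 p.2 : ℝ)| = 1 := by
      simp only [signMatrix]; split_ifs <;> simp
    have h2 := (hmem p.1 p.2).trans (le_abs_self _)
    rw [abs_mul, h1, one_mul] at h2
    have h3 := one_div_le_one_div_of_le (by positivity) h2
    rwa [one_div_one_div] at h3

/-- Under any distribution the sign matrix has correlation at least `1` with `-G`. Each of the `N`
rectangles of `G` contributes at most the discrepancy under that distribution. -/
theorem IsSignRect.le_disc [Fintype X] [Fintype Y] [Nonempty X] [Nonempty Y] {f : BoolMat X Y} (hN : 0 < N)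
    (hf : IsSignRect N f) : 1 / (N : ℝ) ≤ disc (signMatrix f) := by
  classical
  obtain ⟨G, ⟨s, a, b, hs, h⟩, hsgn⟩ := hf
  have hN' : (0 : ℝ) < N := by exact_mod_cast hN
  -- Without any distribution the infimum would take the default value `0`.
  have : Nonempty (stdSimplex ℝ (X × Y)) :=
    ⟨⟨_, single_mem_stdSimplex ℝ (Classical.arbitrary (X × Y))⟩⟩
  refine le_ciInf fun μ => ?_
  set D := ⨆ R : Finset X × Finset Y,
    |∑ x ∈ R.1, ∑ y ∈ R.2, μ.1 (x, y) * signMatrix f x y| with hD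
  have hR : ∀ i, |∑ x, ∑ y, if (a i x && b i y) = true then μ.1 (x, y) * signMatrix f x y else 0|
      ≤ D := by
    intro i
    have := le_ciSup (f := fun R : Finset X × Finset Y =>
      |∑ x ∈ R.1, ∑ y ∈ R.2, μ.1 (x, y) * signMatrix f x y|) (Set.finite_range _).bddAbove
      (Finset.univ.filter fun x => a i x = true, Finset.univ.filter fun y => b i y = true)
    refine le_trans (le_of_eq ?_) this
    congr 1
    simp only [Finset.sum_filter]
    refine Finset.sum_congr rfl fun x _ => ?_
    by_cases h1 : a i x = true <;> simp [h1]
  have h1 : (1 : ℝ) ≤ ∑ x, ∑ y, μ.1 (x, y) * (signMatrix f x y * (-1 * (G x y : ℝ))) := by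
    calc (1 : ℝ) = ∑ x, ∑ y, μ.1 (x, y) := by rw [← Fintype.sum_prod_type, μ.2.2]
      _ ≤ _ := Finset.sum_le_sum fun x _ => Finset.sum_le_sum fun y _ =>
        le_mul_of_one_le_right (μ.2.1 _) (one_le_signMatrix_mul hsgn x y)
  have h2 : ∑ x, ∑ y, μ.1 (x, y) * (signMatrix f x y * (-1 * (G x y : ℝ)))
      = ∑ i, -(s i : ℝ) *
        ∑ x, ∑ y, if (a i x && b i y) = true then μ.1 (x, y) * signMatrix f x y else 0 := by
    simp only [Finset.mul_sum]
    symm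
    rw [Finset.sum_comm]
    refine Finset.sum_congr rfl fun x _ => ?_
    rw [Finset.sum_comm]
    refine Finset.sum_congr rfl fun y _ => ?_
    rw [h]
    push_cast
    simp only [Finset.mul_sum]
    refine Finset.sum_congr rfl fun i _ => ?_
    split_ifs
    · ring
    · simp
  have h3 : ∑ i, -(s i : ℝ) *
        (∑ x, ∑ y, if (a i x && b i y) = true then μ.1 (x, y) * signMatrix f x y else 0)
      ≤ N * D := by
    refine (Finset.sum_le_card_nsmul _ _ D fun i _ => ?_).trans (by simp)
    refine (le_abs_self _).trans ?_
    rw [abs_mul, abs_neg]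
    have : |(s i : ℝ)| ≤ 1 := by exact_mod_cast hs i
    exact (mul_le_of_le_one_left (abs_nonneg _) this).trans (hR i)
  rw [div_le_iff₀ hN']
  linarith

end

/-! ### The three measures as lower-bound methods for PP. -/

theorem logb_natCast_two_pow_le {v : ℝ} (hv : 0 ≤ v) {c : ℕ} (h : v ≤ ((2 ^ c : ℕ) : ℝ)) :
    Real.logb 2 v ≤ c := by
  -- A measure of value `0` is harmless, since `Real.logb 2 0 = 0`.
  rcases hv.eq_or_lt with rfl | hv
  · simp
  · rw [Real.logb_le_iff_le_rpow one_lt_two hv, Real.rpow_natCast]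
    exact_mod_cast h

theorem isLowerBoundMethod_PPcc_of_le {Λ : CCMeasure}
    (h : ∀ (n c : ℕ) (f : BoolMat (Bits n) (Bits n)), IsSignRect (2 ^ c) f → Λ n f ≤ c) :
    IsLowerBoundMethod PPcc Λ := by
  intro L hL
  refine (PolylogBounded.add hL (.const 3)).mono (Eventually.of_forall fun n => ?_)
  have := h n _ (L n) (isSignRect_ppComplexity (L n))
  exact_mod_cast this

theorem isLowerBoundMethod_discMethod : IsLowerBoundMethod PPcc discMethod :=
  isLowerBoundMethod_PPcc_of_le fun n c f hf => by
    have h := hf.le_disc (by positivity)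
    have hpos : (0 : ℝ) < 1 / ((2 ^ c : ℕ) : ℝ) := by positivity
    refine logb_natCast_two_pow_le (one_div_nonneg.2 (hpos.le.trans h)) ?_
    simpa only [one_div_one_div] using one_div_le_one_div_of_le hpos h

theorem isLowerBoundMethod_gammaTwoInftyMethod : IsLowerBoundMethod PPcc gammaTwoInftyMethod :=
  isLowerBoundMethod_PPcc_of_le fun _ _ _ hf =>
    logb_natCast_two_pow_le (gammaTwoInfty_nonneg _) hf.gammaTwoInfty_le

theorem isLowerBoundMethod_marginMethod : IsLowerBoundMethod PPcc marginMethod :=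
  isLowerBoundMethod_PPcc_of_le fun _ _ _ hf =>
    logb_natCast_two_pow_le (marginComplexity_nonneg _) (hf.marginComplexity_le (by positivity))

/-! ### The BP-operator and mc-rigidity -/

theorem eventually_one_div_succ_le {ε : ℝ} (hε : 0 < ε) :
    ∀ᶠ n : ℕ in atTop, 1 / ((n : ℝ) + 1) ≤ ε :=
  (tendsto_one_div_add_atTop_nhds_zero_nat.eventually (gt_mem_nhds hε)).mono fun _ h => h.le

instance (n : ℕ) : Nonempty (stdSimplex ℝ (Bits n × Bits n)) :=
  ⟨⟨_, single_mem_stdSimplex ℝ (Classical.arbitrary (Bits n × Bits n))⟩⟩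

/-- There are finitely many sign patterns of size `2 ^ b n` for each `n`, so one of them maximizes
`Λ n`. The maximizers form a single language `L'` in PP, on which `Λ` is polylogarithmic by
hypothesis, and `Λ n (L' n)` bounds the inner minimum for every distribution at once. -/
theorem IsLowerBoundMethod.bp {Λ : CCMeasure} (hΛ : IsLowerBoundMethod PPcc Λ) {ε : ℝ}
    (hε : 0 < ε) : IsLowerBoundMethod PHcc (Λ.bp ε) := by
  intro L hL
  obtain ⟨b, hb, hg⟩ := exists_isSignRect_of_mem_PHcc hL
  have hmax : ∀ n, ∃ g : BoolMat (Bits n) (Bits n), IsSignRect (2 ^ b n) g ∧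
      ∀ g', IsSignRect (2 ^ b n) g' → Λ n g' ≤ Λ n g := fun n => by
    obtain ⟨g₀, hg₀, -⟩ := hg n (Classical.arbitrary _)
    exact Set.exists_max_image {g | IsSignRect (2 ^ b n) g} (Λ n) (Set.toFinite _) ⟨g₀, hg₀⟩
  choose L' hL' hmax using hmax
  have hPP : L' ∈ PPcc := by
    refine PolylogBounded.mono (hb.add (.const 3)) (Eventually.of_forall fun n => ?_)
    have := (hL' n).ppComplexity_le (by positivity)
    rw [← pow_succ, Nat.clog_pow _ _ one_lt_two] at this
    exact_mod_cast this
  refine (hΛ L' hPP).mono ?_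
  filter_upwards [eventually_one_div_succ_le hε] with n hn
  refine ciSup_le fun μ => ?_
  obtain ⟨g, hg1, hg2⟩ := hg n μ
  exact (ciInf_le (Set.finite_range _).bddBelow (⟨g, hg2.trans hn⟩ :
    {g : BoolMat (Bits n) (Bits n) // errorProb μ (L n) g ≤ ε})).trans (hmax n g hg1)

/-- Under the uniform distribution the error counts changed entries. The exponent `k` depends only
on the size `b`, and the error `1/(n + 1)` falls below every `ε`, so one `k` serves all `ε`. -/
theorem mcRigidity_le_of_mem_PHcc {L : CCLanguage} (hL : L ∈ PHcc) :
    ∃ k : ℕ, ∀ ε : ℝ, 0 < ε → ∀ᶠ n : ℕ in atTop,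
      (mcRigidity (L n) (2 ^ ((Real.logb 2 (n : ℝ)) ^ k)) : ℝ) ≤ ε * 4 ^ n := by
  obtain ⟨b, ⟨k, hk⟩, hg⟩ := exists_isSignRect_of_mem_PHcc hL
  refine ⟨k, fun ε hε => ?_⟩
  filter_upwards [hk, eventually_one_div_succ_le hε] with n h1 h2
  have hcard : (Fintype.card (Bits n × Bits n) : ℝ) = 4 ^ n := by
    rw [Fintype.card_prod]
    simp only [Fintype.card_fun, Fintype.card_bool, Fintype.card_fin]
    push_cast
    rw [← mul_pow]; norm_num
  let μ : stdSimplex ℝ (Bits n × Bits n) := ⟨fun _ => 1 / 4 ^ n, fun _ => by positivity, by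
    rw [Finset.sum_const, Finset.card_univ, nsmul_eq_mul, hcard]; field_simp⟩
  obtain ⟨g, hg1, hg2⟩ := hg n μ
  have h3 : mcRigidity (L n) (2 ^ ((Real.logb 2 (n : ℝ)) ^ k)) ≤
      (Finset.univ.filter fun p : Bits n × Bits n => L n p.1 p.2 ≠ g p.1 p.2).card := by
    refine Nat.sInf_le ⟨g, (hg1.marginComplexity_le (by positivity)).trans ?_, rfl⟩
    push_cast
    rw [← Real.rpow_natCast]
    exact Real.rpow_le_rpow_of_exponent_le one_le_two h1
  have h4 : errorProb μ (L n) g =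
      (Finset.univ.filter fun p : Bits n × Bits n => L n p.1 p.2 ≠ g p.1 p.2).card / 4 ^ n := by
    rw [errorProb, ← Finset.sum_filter, Finset.sum_const, nsmul_eq_mul, mul_one_div]
  have h5 := hg2.trans h2
  rw [h4, div_le_iff₀ (by positivity)] at h5
  exact le_trans (by exact_mod_cast h3) h5

end CommCC

/-! ### The corollary. -/

theorem mainTheorem6 :
    (∀ Λ : CommCC.CCMeasure, CommCC.IsLowerBoundMethod CommCC.PPcc Λ →
      ∀ ε : ℝ, 0 < ε → ε < 1 / 2 → CommCC.IsLowerBoundMethod CommCC.PHcc (Λ.bp ε)) ∧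
    (∀ Λ : CommCC.CCMeasure,
      (Λ = CommCC.discMethod ∨ Λ = CommCC.gammaTwoInftyMethod ∨ Λ = CommCC.marginMethod) →
      CommCC.IsLowerBoundMethod CommCC.PPcc Λ ∧
      ∀ ε : ℝ, 0 < ε → ε < 1 / 2 → CommCC.IsLowerBoundMethod CommCC.PHcc (Λ.bp ε)) ∧
    (∀ L ∈ CommCC.PHcc, ∃ k : ℕ, ∀ ε : ℝ, 0 < ε → ∀ᶠ n : ℕ in Filter.atTop,
      (CommCC.mcRigidity (L n) (2 ^ ((Real.logb 2 (n : ℝ)) ^ k)) : ℝ) ≤ ε * 4 ^ n) := by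
  refine ⟨fun Λ hΛ ε hε _ => hΛ.bp hε, fun Λ hΛ => ?_, fun L hL =>
    CommCC.mcRigidity_le_of_mem_PHcc hL⟩
  have hPP : CommCC.IsLowerBoundMethod CommCC.PPcc Λ := by
    rcases hΛ with rfl | rfl | rfl
    · exact CommCC.isLowerBoundMethod_discMethod
    · exact CommCC.isLowerBoundMethod_gammaTwoInftyMethod
    · exact CommCC.isLowerBoundMethod_marginMethod
  exact ⟨hPP, fun ε hε _ => hPP.bp hε⟩
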